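/- Let $k\ge 2$ be an integer and let $F(z)\in\mathbb{C}[[z]]$ be a $k$-Mahler function, that is, suppose there exist an integer $d\ge 0$ and polynomials $a_0(z),\dots,a_d(z)\in\mathbb{C}[z]$ with $a_0(z)a_d(z)\neq 0$ such that $$a_0(z)F(z)+a_1(z)F(z^k)+\cdots+a_d(z)F(z^{k^d})=0 .$$ If $F(z)$ is algebraic over $\mathbb{C}(z)$, then $F(z)$ is a rational function. (Equivalently, a $k$-Mahler function in $\mathbb{C}[[z]]$ is either rational or transcendental over $\mathbb{C}(z)$.) -/

import Mathlib

open scoped Polynomial PowerSeries LaurentSeries RatFunc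

/-- The power series `F(z^n)` (for `n ≥ 1`), obtained from `F(z)` by substituting `z^n` for `z`. -/
noncomputable def substPow (n : ℕ) (F : ℂ⟦X⟧) : ℂ⟦X⟧ :=
  PowerSeries.subst (PowerSeries.X ^ n : ℂ⟦X⟧) F

/-- A formal power series `F(z)` over `ℂ` is `k`-Mahler if there are `d ≥ 0` and polynomials
`a₀(z), …, a_d(z)` with `a₀(z) a_d(z) ≠ 0` such that
`a₀(z) F(z) + a₁(z) F(z^k) + ⋯ + a_d(z) F(z^(k^d)) = 0`. -/
def IsMahler (k : ℕ) (F : ℂ⟦X⟧) : Prop :=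
  ∃ (d : ℕ) (a : Fin (d + 1) → ℂ[X]), a 0 * a (Fin.last d) ≠ 0 ∧
    ∑ j : Fin (d + 1), (a j : ℂ⟦X⟧) * substPow (k ^ (j : ℕ)) F = 0

/-- `F(z)` is algebraic over the field `ℂ(z)` of rational functions, inside the field `ℂ((z))` of
Laurent series. -/
def IsAlgebraicSeries (F : ℂ⟦X⟧) : Prop :=
  IsAlgebraic (RatFunc ℂ) (F : ℂ⸨X⸩)

/-- `F(z)` is a rational function: it belongs to the subfield `ℂ(z)` of `ℂ((z))`. -/
def IsRationalSeries (F : ℂ⟦X⟧) : Prop :=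
  ∃ r : RatFunc ℂ, algebraMap (RatFunc ℂ) ℂ⸨X⸩ r = (F : ℂ⸨X⸩)

/-! Write σ for z ↦ z^k and θ for z d/dz, so that θσ = kσθ. Since F is algebraic and Mahler,
finitely many of the series F(z^(k^i)) generate a finite extension L of ℂ(z) containing F and stable
under σ and θ. Multiplying F by a nonzero polynomial gives f in L integral over ℂ[z]. Expand all θ^m
f in one integral basis of L.

At 0 and ∞, σ^n multiplies the pole order of the coordinates by k^n, up to O(k^n), while θ^m adds
only O(m). Comparing θ^m σ^n f with σ^n θ^m f for large n bounds these orders independently of m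
(`exists_forall_poleNorm_iterate_theta_le`).

Elsewhere, σ^n f stays integral, so the poles of θ^m σ^n f lie in a finite set independent of n. A
pole of θ^m f at a ≠ 0, beyond the discriminant, would yield k^n poles, one at each k^n-th root of
a: too many (`exists_X_pow_mul_discr_mul_repr`).

Up to a fixed factor, the coordinates of all θ^m f are thus polynomials of bounded degree, and the
θ^m f are linearly dependent over ℂ. A relation P(θ) f = 0 reads P(n) f_n = 0 on coefficients, so f
is a Laurent polynomial and F is rational. -/

/-- The substitution `z ↦ z ^ N` on Laurent series. -/
noncomputable def dilate (N : ℕ) [NeZero N] : ℂ⸨X⸩ →+* ℂ⸨X⸩ :=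
  HahnSeries.embDomainRingHom (AddMonoidHom.mulLeft (N : ℤ))
    (fun _ _ h => mul_left_cancel₀ (Nat.cast_ne_zero.2 (NeZero.ne N)) h)
    (fun _ _ => mul_le_mul_iff_right₀ (Nat.cast_pos.2 (NeZero.pos N)))

/-! ### Substitution z ↦ z^N on series, polynomials and rational functions. -/

section dilate
variable (N : ℕ) [NeZero N]

theorem coeff_dilate_mul (f : ℂ⸨X⸩) (n : ℤ) : (dilate N f).coeff (N * n) = f.coeff n :=
  HahnSeries.embDomain_coeff (a := n)

theorem coeff_dilate_of_not_dvd (f : ℂ⸨X⸩) {n : ℤ} (h : ¬ (N : ℤ) ∣ n) :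
    (dilate N f).coeff n = 0 :=
  HahnSeries.embDomain_of_notMem_range (by rintro ⟨a, rfl⟩; exact h ⟨a, rfl⟩)

theorem dilate_ext_iff {f g : ℂ⸨X⸩} : dilate N f = g ↔
    (∀ n : ℤ, g.coeff (N * n) = f.coeff n) ∧ ∀ n : ℤ, ¬ (N : ℤ) ∣ n → g.coeff n = 0 := by
  constructor
  · rintro rfl
    exact ⟨fun n => coeff_dilate_mul N f n, fun n => coeff_dilate_of_not_dvd N f⟩
  · rintro ⟨h₁, h₂⟩
    ext n
    by_cases h : (N : ℤ) ∣ n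
    · obtain ⟨m, rfl⟩ := h
      rw [coeff_dilate_mul, h₁]
    · rw [coeff_dilate_of_not_dvd N f h, h₂ n h]

theorem dilate_dilate (M : ℕ) [NeZero M] (f : ℂ⸨X⸩) :
    dilate M (dilate N f) = dilate (M * N) f := by
  symm
  rw [dilate_ext_iff]
  refine ⟨fun n => ?_, fun n hn => ?_⟩
  · rw [Nat.cast_mul, mul_assoc, coeff_dilate_mul, coeff_dilate_mul]
  · by_cases h : (M : ℤ) ∣ n
    · obtain ⟨m, rfl⟩ := h
      rw [coeff_dilate_mul, coeff_dilate_of_not_dvd]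
      intro h'
      exact hn (by rw [Nat.cast_mul]; exact mul_dvd_mul_left _ h')
    · rw [coeff_dilate_of_not_dvd _ _ h]

theorem dilate_one_apply (f : ℂ⸨X⸩) : dilate 1 f = f := by
  rw [dilate_ext_iff]
  exact ⟨fun n => by simp, fun n h => (h (by simp)).elim⟩

theorem dilate_coe (F : ℂ⟦X⟧) : dilate N (F : ℂ⸨X⸩) = (substPow N F : ℂ⟦X⟧) := by
  rw [dilate_ext_iff]
  have hN : (0 : ℤ) < N := Nat.cast_pos.2 (NeZero.pos N)
  refine ⟨fun n => ?_, fun n hn => ?_⟩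
  · rw [PowerSeries.coeff_coe, PowerSeries.coeff_coe]
    by_cases h : n < 0
    · rw [if_pos h, if_pos (mul_neg_of_pos_of_neg hN h)]
    · have h' : ¬ (N : ℤ) * n < 0 := not_lt.2 (mul_nonneg hN.le (not_lt.1 h))
      rw [if_neg h, if_neg h', substPow, PowerSeries.coeff_subst_X_pow (NeZero.ne N),
        Int.natAbs_mul, Int.natAbs_natCast, if_pos (dvd_mul_right _ _),
        Nat.mul_div_cancel_left _ (NeZero.pos N)]
      rfl
  · rw [PowerSeries.coeff_coe]
    split_ifs with h
    · rfl
    · rw [substPow, PowerSeries.coeff_subst_X_pow (NeZero.ne N), if_neg]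
      rwa [← Int.natCast_dvd]

theorem algebraMap_polynomial_eq_coe (p : ℂ[X]) :
    algebraMap ℂ[X] ℂ⸨X⸩ p = ((p : ℂ⟦X⟧) : ℂ⸨X⸩) := rfl

theorem substPow_coe (p : ℂ[X]) : substPow N (p : ℂ⟦X⟧) = (Polynomial.expand ℂ N p : ℂ[X]) := by
  ext n
  rw [substPow, PowerSeries.coeff_subst_X_pow (NeZero.ne N), Polynomial.coeff_coe, Polynomial.coeff_coe,
    Polynomial.coeff_expand (NeZero.pos N)]
  rfl

theorem dilate_algebraMap_polynomial (p : ℂ[X]) :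
    dilate N (algebraMap ℂ[X] ℂ⸨X⸩ p) = algebraMap ℂ[X] ℂ⸨X⸩ (Polynomial.expand ℂ N p) := by
  rw [algebraMap_polynomial_eq_coe, dilate_coe, substPow_coe, algebraMap_polynomial_eq_coe]

/-- The substitution `z ↦ z ^ N` on rational functions. -/
noncomputable def ratDilate : RatFunc ℂ →+* RatFunc ℂ :=
  RatFunc.mapRingHom (Polynomial.expand ℂ N) (by
    intro p hp
    rw [Submonoid.mem_comap]
    exact mem_nonZeroDivisors_of_ne_zero
      ((Polynomial.expand_ne_zero (NeZero.pos N)).2 (nonZeroDivisors.ne_zero hp)))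

theorem ratDilate_algebraMap (p : ℂ[X]) :
    ratDilate N (algebraMap ℂ[X] (RatFunc ℂ) p) =
      algebraMap ℂ[X] (RatFunc ℂ) (Polynomial.expand ℂ N p) := by
  rw [ratDilate, RatFunc.coe_mapRingHom_eq_coe_map, RatFunc.map_apply]
  simp

theorem algebraMap_ratDilate (x : RatFunc ℂ) :
    algebraMap (RatFunc ℂ) ℂ⸨X⸩ (ratDilate N x) = dilate N (algebraMap (RatFunc ℂ) ℂ⸨X⸩ x) := by
  induction x using RatFunc.induction_on with
  | f p q hq =>
    simp only [map_div₀, ratDilate_algebraMap]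
    simp only [← IsScalarTower.algebraMap_apply ℂ[X] (RatFunc ℂ) ℂ⸨X⸩,
      dilate_algebraMap_polynomial]

end dilate

/-! ### The Euler derivation on Laurent series. -/

section theta

/-- The Euler derivation `z d/dz` on Laurent series, as a linear map. -/
noncomputable def thetaLin : ℂ⸨X⸩ →ₗ[ℂ] ℂ⸨X⸩ where
  toFun f := ⟨fun n => (n : ℂ) * f.coeff n, f.isPWO_support.mono fun n hn h => hn (by simp [h])⟩
  map_add' f g := by ext n; simp [mul_add]
  map_smul' c f := by ext n; simp [mul_left_comm]

theorem coeff_thetaLin (f : ℂ⸨X⸩) (n : ℤ) : (thetaLin f).coeff n = n * f.coeff n := rfl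

theorem thetaLin_mul (f g : ℂ⸨X⸩) : thetaLin (f * g) = f * thetaLin g + g * thetaLin f := by
  ext n
  have hs : ∀ h : ℂ⸨X⸩, (thetaLin h).support ⊆ h.support := fun h m hm h' =>
    hm (by simp [coeff_thetaLin, h'])
  rw [mul_comm g, HahnSeries.coeff_add, coeff_thetaLin, HahnSeries.coeff_mul,
    HahnSeries.coeff_mul_right' g.isPWO_support (hs g),
    HahnSeries.coeff_mul_left' f.isPWO_support (hs f), Finset.mul_sum, ← Finset.sum_add_distrib]
  refine Finset.sum_congr rfl fun ij hij => ?_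
  rw [coeff_thetaLin, coeff_thetaLin, ← (Finset.mem_antidiagonal.1 hij).2.2]
  push_cast
  ring

/-- This commutation rule drives both pole estimates: it trades growth under θ against growth under
substitution. -/
theorem thetaLin_dilate (N : ℕ) [NeZero N] (f : ℂ⸨X⸩) :
    thetaLin (dilate N f) = (N : ℂ) • dilate N (thetaLin f) := by
  ext n
  rw [coeff_thetaLin, HahnSeries.coeff_smul]
  by_cases h : (N : ℤ) ∣ n
  · obtain ⟨m, rfl⟩ := h
    rw [coeff_dilate_mul, coeff_dilate_mul, coeff_thetaLin]
    push_cast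
    rw [smul_eq_mul, mul_assoc]
  · rw [coeff_dilate_of_not_dvd N f h, coeff_dilate_of_not_dvd N _ h]
    simp

theorem thetaLin_algebraMap_polynomial (p : ℂ[X]) :
    thetaLin (algebraMap ℂ[X] ℂ⸨X⸩ p) =
      algebraMap ℂ[X] ℂ⸨X⸩ (Polynomial.X * Polynomial.derivative p) := by
  ext n
  rw [coeff_thetaLin, algebraMap_polynomial_eq_coe, algebraMap_polynomial_eq_coe,
    PowerSeries.coeff_coe, PowerSeries.coeff_coe]
  split_ifs with h
  · simp
  · obtain ⟨m, rfl⟩ := Int.eq_ofNat_of_zero_le (not_lt.1 h)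
    cases m with
    | zero => simp
    | succ m =>
      have : Int.natAbs ((m + 1 : ℕ) : ℤ) = m + 1 := rfl
      rw [this, Polynomial.coeff_coe, Polynomial.coeff_coe, Polynomial.coeff_X_mul,
        Polynomial.coeff_derivative]
      push_cast
      ring

end theta

/-! ### Substitution preserves linear independence over ℂ(z). -/

theorem algebraMap_monomial (s : ℕ) (c : ℂ) :
    algebraMap ℂ[X] ℂ⸨X⸩ (Polynomial.monomial s c) = HahnSeries.single (s : ℤ) c := by
  rw [← Polynomial.C_mul_X_pow_eq_monomial, algebraMap_polynomial_eq_coe]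
  simp [PowerSeries.coe_mul, PowerSeries.coe_pow]

/-- Only exponents of `p` divisible by `N` can contribute at an index divisible by `N`, and
`contract` keeps exactly these. -/
theorem coeff_mul_dilate (N : ℕ) [NeZero N] (p : ℂ[X]) (h : ℂ⸨X⸩) (n : ℤ) :
    (algebraMap ℂ[X] ℂ⸨X⸩ p * dilate N h).coeff (N * n) =
      (algebraMap ℂ[X] ℂ⸨X⸩ (p.contract N) * h).coeff n := by
  induction p using Polynomial.induction_on' with
  | add p q hp hq =>
    rw [map_add, add_mul, HahnSeries.coeff_add, hp, hq, Polynomial.contract_add (NeZero.ne N), map_add,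
      add_mul, HahnSeries.coeff_add]
  | monomial s c =>
    rw [algebraMap_monomial, HahnSeries.coeff_single_mul]
    by_cases hs : N ∣ s
    · obtain ⟨t, rfl⟩ := hs
      have : (Polynomial.monomial (N * t) c).contract N = Polynomial.monomial t c := by
        ext m
        rw [Polynomial.coeff_contract (NeZero.ne N), Polynomial.coeff_monomial,
          Polynomial.coeff_monomial, mul_comm m]
        exact if_congr (Nat.mul_right_inj (NeZero.ne N)) rfl rfl
      rw [this, algebraMap_monomial, HahnSeries.coeff_single_mul, Nat.cast_mul, ← mul_sub,
        coeff_dilate_mul]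
    · have : (Polynomial.monomial s c).contract N = 0 := by
        ext m
        rw [Polynomial.coeff_contract (NeZero.ne N), Polynomial.coeff_monomial, if_neg]
        · rfl
        · rintro rfl
          exact hs (dvd_mul_left _ _)
      rw [this, map_zero, zero_mul, coeff_dilate_of_not_dvd, mul_zero, HahnSeries.coeff_zero]
      intro h
      exact hs (Int.natCast_dvd_natCast.1 ((dvd_sub_right (dvd_mul_right _ _)).1 h))

theorem Polynomial.eq_zero_of_forall_contract_X_pow_mul (N : ℕ) [NeZero N] {p : ℂ[X]}
    (h : ∀ t : ℕ, (Polynomial.X ^ t * p).contract N = 0) : p = 0 := by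
  ext s
  -- This shift moves coefficient `s` to exponent `s * N`, which contraction reads at index `s`.
  have := congrArg (fun q : ℂ[X] => q.coeff s) (h (s * N - s))
  simp only [Polynomial.coeff_contract (NeZero.ne N), Polynomial.coeff_X_pow_mul'] at this
  rw [if_pos (Nat.sub_le _ _), Nat.sub_sub_self (Nat.le_mul_of_pos_right _ (NeZero.pos N))] at this
  exact this

/-- Clear denominators in a relation, multiply by X^t and keep the indices divisible by `N`: a
relation among the `e i` with contracted coefficients remains. Letting t vary kills every
coefficient. -/
theorem linearIndependent_dilate (N : ℕ) [NeZero N] {ι : Type*} {e : ι → ℂ⸨X⸩}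
    (he : LinearIndependent (RatFunc ℂ) e) :
    LinearIndependent (RatFunc ℂ) fun i => dilate N (e i) := by
  rw [← LinearIndependent.iff_fractionRing ℂ[X]] at he ⊢
  rw [linearIndependent_iff'] at he ⊢
  intro s g hg i hi
  refine Polynomial.eq_zero_of_forall_contract_X_pow_mul N fun t => ?_
  refine he s (fun i => (Polynomial.X ^ t * g i).contract N) ?_ i hi
  ext n
  have := congrArg (fun f : ℂ⸨X⸩ => (algebraMap ℂ[X] ℂ⸨X⸩ (Polynomial.X ^ t) * f).coeff (N * n)) hg
  simp only [mul_zero, HahnSeries.coeff_zero, Finset.mul_sum, HahnSeries.coeff_sum,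
    Algebra.smul_def, ← mul_assoc, ← map_mul, coeff_mul_dilate] at this ⊢
  exact this

/-! ### Rational functions: the Euler derivation and pole orders at 0 and ∞. -/

/-- The Euler derivation `z d/dz` on rational functions. -/
noncomputable def ratTheta (x : RatFunc ℂ) : RatFunc ℂ :=
  algebraMap ℂ[X] (RatFunc ℂ)
    ((Polynomial.X * Polynomial.derivative x.num) * x.denom -
      x.num * (Polynomial.X * Polynomial.derivative x.denom)) /
    algebraMap ℂ[X] (RatFunc ℂ) (x.denom * x.denom)

theorem algebraMap_ratTheta (x : RatFunc ℂ) :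
    algebraMap (RatFunc ℂ) ℂ⸨X⸩ (ratTheta x) = thetaLin (algebraMap (RatFunc ℂ) ℂ⸨X⸩ x) := by
  have hd : algebraMap ℂ[X] ℂ⸨X⸩ x.denom ≠ 0 :=
    (map_ne_zero_iff _ (FaithfulSMul.algebraMap_injective _ _)).2 x.denom_ne_zero
  have hx : algebraMap ℂ[X] ℂ⸨X⸩ x.denom * algebraMap (RatFunc ℂ) ℂ⸨X⸩ x =
      algebraMap ℂ[X] ℂ⸨X⸩ x.num := by
    conv_lhs => rw [← RatFunc.num_div_denom x]
    rw [map_div₀, ← IsScalarTower.algebraMap_apply, ← IsScalarTower.algebraMap_apply,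
      RatFunc.num_div_denom, mul_div_cancel₀ _ hd]
  have h := congrArg thetaLin hx
  rw [thetaLin_mul, thetaLin_algebraMap_polynomial, thetaLin_algebraMap_polynomial] at h
  rw [ratTheta, map_div₀, ← IsScalarTower.algebraMap_apply, ← IsScalarTower.algebraMap_apply,
    map_mul, div_eq_iff (mul_ne_zero hd hd), map_sub, map_mul _ (_ * _), map_mul _ (RatFunc.num x),
    ← h, ← hx]
  ring

/-- A function measuring the order of the pole at `0` or at `∞` of a rational function. -/
structure IsPoleOrder (w : RatFunc ℂ → ℕ) : Prop where
  zero : w 0 = 0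
  add : ∀ x y, w (x + y) ≤ max (w x) (w y)
  mul : ∀ x y, w (x * y) ≤ w x + w y
  dilate : ∀ (N : ℕ) [NeZero N] (x : RatFunc ℂ), w (ratDilate N x) = N * w x
  theta : ∀ x, w (ratTheta x) ≤ w x

theorem IsPoleOrder.sum {w : RatFunc ℂ → ℕ} (hw : IsPoleOrder w) {ι : Type*} (s : Finset ι)
    (f : ι → RatFunc ℂ) {B : ℕ} (h : ∀ i ∈ s, w (f i) ≤ B) : w (∑ i ∈ s, f i) ≤ B :=
  Finset.sum_induction f (fun x => w x ≤ B) (fun _ _ ha hb => (hw.add _ _).trans (max_le ha hb))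
    (hw.zero.trans_le (Nat.zero_le _)) h

/-- The order of the pole at `0`. -/
noncomputable def poleOrderZero (x : RatFunc ℂ) : ℕ :=
  (-(algebraMap (RatFunc ℂ) ℂ⸨X⸩ x).order).toNat

/-- The order of the pole at `∞`. -/
noncomputable def poleOrderInfty (x : RatFunc ℂ) : ℕ := x.intDegree.toNat

theorem order_dilate (N : ℕ) [NeZero N] (f : ℂ⸨X⸩) : (dilate N f).order = N * f.order := by
  have hN : (0 : ℤ) < N := Nat.cast_pos.2 (NeZero.pos N)
  by_cases hf : f = 0
  · simp [hf]
  have hf' : dilate N f ≠ 0 := (map_ne_zero _).2 hf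
  apply le_antisymm
  · apply HahnSeries.order_le_of_coeff_ne_zero
    rw [coeff_dilate_mul]
    exact mt HahnSeries.coeff_order_eq_zero.1 hf
  · rw [HahnSeries.le_order_iff_forall hf']
    intro j hj
    by_cases h : (N : ℤ) ∣ j
    · obtain ⟨m, rfl⟩ := h
      rw [coeff_dilate_mul]
      exact HahnSeries.coeff_eq_zero_of_lt_order (lt_of_mul_lt_mul_left hj hN.le)
    · exact coeff_dilate_of_not_dvd N f h

theorem toNat_natCast_mul (N : ℕ) (a : ℤ) : ((N : ℤ) * a).toNat = N * a.toNat := by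
  rcases le_total 0 a with h | h
  · lift a to ℕ using h
    exact_mod_cast Int.toNat_natCast (N * a)
  · rw [Int.toNat_of_nonpos h, mul_zero,
      Int.toNat_of_nonpos (mul_nonpos_of_nonneg_of_nonpos (Nat.cast_nonneg N) h)]

theorem isPoleOrder_poleOrderZero : IsPoleOrder poleOrderZero where
  zero := by simp [poleOrderZero]
  add x y := by
    simp only [poleOrderZero, map_add]
    by_cases h : algebraMap (RatFunc ℂ) ℂ⸨X⸩ x + algebraMap (RatFunc ℂ) ℂ⸨X⸩ y = 0
    · simp [h]
    · have := HahnSeries.min_order_le_order_add h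
      omega
  mul x y := by
    simp only [poleOrderZero, map_mul]
    by_cases hx : algebraMap (RatFunc ℂ) ℂ⸨X⸩ x = 0
    · simp [hx]
    by_cases hy : algebraMap (RatFunc ℂ) ℂ⸨X⸩ y = 0
    · simp [hy]
    rw [HahnSeries.order_mul hx hy]
    omega
  dilate N _ x := by
    rw [poleOrderZero, algebraMap_ratDilate, order_dilate, poleOrderZero, ← mul_neg,
      toNat_natCast_mul]
  theta x := by
    rw [poleOrderZero, algebraMap_ratTheta, poleOrderZero]
    by_cases h : thetaLin (algebraMap (RatFunc ℂ) ℂ⸨X⸩ x) = 0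
    · simp [h]
    · have h' := mt HahnSeries.coeff_order_eq_zero.1 h
      rw [coeff_thetaLin] at h'
      have := HahnSeries.order_le_of_coeff_ne_zero (right_ne_zero_of_mul h')
      omega

theorem natDegree_X_mul_derivative_le (p : ℂ[X]) :
    (Polynomial.X * Polynomial.derivative p).natDegree ≤ p.natDegree := by
  by_cases h : p.natDegree = 0
  · rw [Polynomial.natDegree_eq_zero.1 h |>.choose_spec.symm]
    simp
  · have h1 := Polynomial.natDegree_mul_le (p := (Polynomial.X : ℂ[X])) (q := Polynomial.derivative p)
    have h2 := Polynomial.natDegree_derivative_le p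
    rw [Polynomial.natDegree_X] at h1
    omega

theorem intDegree_ratDilate (N : ℕ) [NeZero N] (x : RatFunc ℂ) :
    (ratDilate N x).intDegree = N * x.intDegree := by
  by_cases hx : x = 0
  · simp [hx]
  have hi := IsFractionRing.injective ℂ[X] (RatFunc ℂ)
  have hn : (Polynomial.expand ℂ N) x.num ≠ 0 :=
    (Polynomial.expand_ne_zero (NeZero.pos N)).2 (RatFunc.num_ne_zero hx)
  have hd : (Polynomial.expand ℂ N) x.denom ≠ 0 :=
    (Polynomial.expand_ne_zero (NeZero.pos N)).2 x.denom_ne_zero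
  conv_lhs => rw [← RatFunc.num_div_denom x]
  rw [map_div₀, ratDilate_algebraMap, ratDilate_algebraMap,
    RatFunc.intDegree_div ((map_ne_zero_iff _ hi).2 hn) ((map_ne_zero_iff _ hi).2 hd),
    RatFunc.intDegree_polynomial, RatFunc.intDegree_polynomial, Polynomial.natDegree_expand,
    Polynomial.natDegree_expand, RatFunc.intDegree]
  push_cast
  ring

theorem intDegree_ratTheta_le (x : RatFunc ℂ) :
    (ratTheta x).intDegree ≤ max x.intDegree 0 := by
  by_cases h0 : (Polynomial.X * Polynomial.derivative x.num) * x.denom -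
      x.num * (Polynomial.X * Polynomial.derivative x.denom) = 0
  · simp [ratTheta, h0]
  have hi := IsFractionRing.injective ℂ[X] (RatFunc ℂ)
  rw [ratTheta, RatFunc.intDegree_div ((map_ne_zero_iff _ hi).2 h0)
    ((map_ne_zero_iff _ hi).2 (mul_ne_zero x.denom_ne_zero x.denom_ne_zero)),
    RatFunc.intDegree_polynomial, RatFunc.intDegree_polynomial,
    Polynomial.natDegree_mul x.denom_ne_zero x.denom_ne_zero, RatFunc.intDegree]
  have h1 := Polynomial.natDegree_sub_le (Polynomial.X * Polynomial.derivative x.num * x.denom)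
    (x.num * (Polynomial.X * Polynomial.derivative x.denom))
  have h2 := (Polynomial.natDegree_mul_le (p := Polynomial.X * Polynomial.derivative x.num)
    (q := x.denom)).trans (Nat.add_le_add_right (natDegree_X_mul_derivative_le _) _)
  have h3 := (Polynomial.natDegree_mul_le (p := x.num)
    (q := Polynomial.X * Polynomial.derivative x.denom)).trans
      (Nat.add_le_add_left (natDegree_X_mul_derivative_le _) _)
  omega

theorem isPoleOrder_poleOrderInfty : IsPoleOrder poleOrderInfty where
  zero := by simp [poleOrderInfty]
  add x y := by
    simp only [poleOrderInfty]
    by_cases hy : y = 0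
    · simp [hy]
    by_cases h : x + y = 0
    · simp [h]
    · have := RatFunc.intDegree_add_le hy h
      omega
  mul x y := by
    simp only [poleOrderInfty]
    by_cases hx : x = 0
    · simp [hx]
    by_cases hy : y = 0
    · simp [hy]
    rw [RatFunc.intDegree_mul hx hy]
    omega
  dilate N _ x := by
    rw [poleOrderInfty, intDegree_ratDilate, poleOrderInfty, toNat_natCast_mul]
  theta x := by
    have := intDegree_ratTheta_le x
    simp only [poleOrderInfty]
    omega

/-- A nonzero pole a of `y` becomes k^n distinct poles of y(z^(k^n)), all roots of the fixed `Q`.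
This is impossible once k^n > deg Q, so the denominator of `y` is a power of X. -/
theorem exists_X_pow_mul_of_forall_ratDilate {k : ℕ} [NeZero k] (hk : 2 ≤ k) {Q : ℂ[X]} (hQ : Q ≠ 0)
    (y : RatFunc ℂ)
    (h : ∀ n : ℕ, ∃ (M : ℕ) (p : ℂ[X]), algebraMap ℂ[X] (RatFunc ℂ) (Q ^ M) * ratDilate (k ^ n) y =
      algebraMap ℂ[X] (RatFunc ℂ) p) :
    ∃ (s : ℕ) (p : ℂ[X]), algebraMap ℂ[X] (RatFunc ℂ) (Polynomial.X ^ s) * y =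
      algebraMap ℂ[X] (RatFunc ℂ) p := by
  have hi := IsFractionRing.injective ℂ[X] (RatFunc ℂ)
  have hdvd : ∀ n : ℕ, ∃ M : ℕ, Polynomial.expand ℂ (k ^ n) y.denom ∣ Q ^ M := by
    intro n
    obtain ⟨M, p, hp⟩ := h n
    refine ⟨M, ?_⟩
    have hd : (Polynomial.expand ℂ (k ^ n)) y.denom ≠ 0 :=
      (Polynomial.expand_ne_zero (NeZero.pos _)).2 y.denom_ne_zero
    rw [← RatFunc.num_div_denom y, map_div₀, ratDilate_algebraMap, ratDilate_algebraMap,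
      ← mul_div_assoc, div_eq_iff ((map_ne_zero_iff _ hi).2 hd), ← map_mul, ← map_mul] at hp
    have hc : IsCoprime (Polynomial.expand ℂ (k ^ n) y.num) (Polynomial.expand ℂ (k ^ n) y.denom) :=
      y.isCoprime_num_denom.map (Polynomial.expand ℂ (k ^ n)).toRingHom
    exact hc.symm.dvd_of_dvd_mul_right ⟨p, by rw [hi hp, mul_comm]⟩
  have hroot : ∀ a : ℂ, y.denom.IsRoot a → a = 0 := by
    intro a ha
    by_contra ha0
    set n := Q.natDegree + 1 with hn
    obtain ⟨M, hM⟩ := hdvd n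
    have h1 : (Polynomial.X ^ (k ^ n) - Polynomial.C a : ℂ[X]) ∣ Q ^ M := by
      refine dvd_trans ?_ hM
      have := map_dvd (Polynomial.expand ℂ (k ^ n)) (Polynomial.dvd_iff_isRoot.2 ha)
      simpa using this
    have hsep := Polynomial.separable_X_pow_sub_C a (n := k ^ n)
      (Nat.cast_ne_zero.2 (NeZero.ne (k ^ n))) ha0
    -- `M` may be 0, so the exponent is raised to `M + 1` before using squarefreeness.
    have h2 : (Polynomial.X ^ (k ^ n) - Polynomial.C a : ℂ[X]) ∣ Q :=
      (hsep.squarefree.dvd_pow_iff_dvd M.succ_ne_zero).1 (h1.trans (pow_dvd_pow _ M.le_succ))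
    have h3 := Polynomial.natDegree_le_of_dvd h2 hQ
    rw [Polynomial.natDegree_X_pow_sub_C] at h3
    have h4 : n < k ^ n := Nat.lt_pow_self (by omega)
    omega
  have hden : y.denom = Polynomial.X ^ y.denom.roots.card := by
    conv_lhs => rw [(IsAlgClosed.splits y.denom).eq_prod_roots_of_monic y.monic_denom]
    rw [Multiset.map_congr rfl (g := fun _ => Polynomial.X), Multiset.map_const',
      Multiset.prod_replicate]
    intro a ha
    rw [hroot a (Polynomial.isRoot_of_mem_roots ha), map_zero, sub_zero]
  refine ⟨y.denom.roots.card, y.num, ?_⟩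
  rw [← hden]
  have hd : algebraMap ℂ[X] (RatFunc ℂ) y.denom ≠ 0 := (map_ne_zero_iff _ hi).2 y.denom_ne_zero
  rw [mul_comm, ← eq_div_iff hd, RatFunc.num_div_denom]

/-! ### Coordinates, traces and discriminants under semilinear maps. -/

section semilinear
variable {K L : Type*} [Field K] [Field L] [Algebra K L] {ι : Type*} [Fintype ι]
  {s : K →+* K} {t : L →+* L} {b b' : Module.Basis ι K L}

theorem Module.Basis.repr_of_semilinear (hst : ∀ x, t (algebraMap K L x) = algebraMap K L (s x))
    (hb : ∀ i, b' i = t (b i)) (x : L) (i : ι) :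
    b'.repr (t x) i = s (b.repr x i) := by
  have : t x = ∑ j, s (b.repr x j) • b' j := by
    conv_lhs => rw [← b.sum_repr x]
    simp only [map_sum, Algebra.smul_def, map_mul, hst, hb]
  rw [this, b'.repr_sum_self]

/-- The matrix of multiplication by `t x` in the basis `b'` is the image under `s` of that of `x` in
`b`. -/
theorem Algebra.trace_of_semilinear (hst : ∀ x, t (algebraMap K L x) = algebraMap K L (s x))
    (hb : ∀ i, b' i = t (b i)) (x : L) :
    Algebra.trace K L (t x) = s (Algebra.trace K L x) := by
  classical
  rw [Algebra.trace_eq_matrix_trace b', Algebra.trace_eq_matrix_trace b, Matrix.trace, Matrix.trace,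
    map_sum]
  refine Finset.sum_congr rfl fun i _ => ?_
  rw [Matrix.diag_apply, Matrix.diag_apply, Algebra.leftMulMatrix_eq_repr_mul,
    Algebra.leftMulMatrix_eq_repr_mul, hb, ← map_mul,
    Module.Basis.repr_of_semilinear hst hb]

theorem Algebra.discr_of_semilinear [DecidableEq ι] (hst : ∀ x, t (algebraMap K L x) = algebraMap K L (s x))
    (hb : ∀ i, b' i = t (b i)) :
    Algebra.discr K b' = s (Algebra.discr K b) := by
  classical
  rw [Algebra.discr_def, Algebra.discr_def, RingHom.map_det]
  congr 1
  ext i j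
  rw [RingHom.mapMatrix_apply, Matrix.map_apply, Algebra.traceMatrix_apply,
    Algebra.traceMatrix_apply, Algebra.traceForm_apply, Algebra.traceForm_apply, hb, hb, ← map_mul,
    Algebra.trace_of_semilinear hst hb]

end semilinear

/-- Cramer's rule for the trace form writes the product as a determinant of traces of integral
elements; it lies in `R` because `R` is integrally closed. -/
theorem Algebra.exists_algebraMap_eq_discr_mul_repr {R K L ι : Type*} [CommRing R] [IsDomain R]
    [Field K] [Field L] [Algebra R K] [Algebra R L] [Algebra K L] [IsScalarTower R K L]
    [FiniteDimensional K L] [Algebra.IsSeparable K L] [IsIntegrallyClosed R] [IsFractionRing R K]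
    [Fintype ι] [DecidableEq ι] (b : Module.Basis ι K L) (hb : ∀ i, IsIntegral R (b i)) {z : L}
    (hz : IsIntegral R z) (i : ι) :
    ∃ r : R, algebraMap R K r = Algebra.discr K b * b.repr z i := by
  classical
  have hinv : IsUnit (traceMatrix K b).det := by
    simpa [← discr_def] using discr_isUnit_of_basis K b
  have H : (traceMatrix K b).det • (traceMatrix K b).mulVec (b.equivFun z) =
      (traceMatrix K b).det • fun i => trace K L (z * b i) := by
    congr; exact traceMatrix_of_basis_mulVec _ _
  have cramer := Matrix.mulVec_cramer (traceMatrix K b) fun i => trace K L (z * b i)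
  rw [← H, ← Matrix.mulVec_smul] at cramer
  replace cramer := congr_arg (Matrix.mulVec (traceMatrix K b)⁻¹) cramer
  rw [Matrix.mulVec_mulVec, Matrix.nonsing_inv_mul _ hinv, Matrix.mulVec_mulVec,
    Matrix.nonsing_inv_mul _ hinv, Matrix.one_mulVec, Matrix.one_mulVec] at cramer
  have hi := congr_fun cramer i
  rw [Pi.smul_apply, Module.Basis.equivFun_apply, smul_eq_mul, ← discr_def] at hi
  rw [← hi, ← IsIntegrallyClosed.isIntegral_iff, Matrix.cramer_apply, Matrix.det_apply]
  refine Subalgebra.sum_mem (integralClosure R K) fun σ _ => Subalgebra.zsmul_mem _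
    (Subalgebra.prod_mem _ fun j _ => ?_) _
  rw [mem_integralClosure_iff]
  by_cases hji : j = i
  · simp only [Matrix.updateCol_apply, hji, if_true]
    exact isIntegral_trace (hz.mul (hb _))
  · simp only [Matrix.updateCol_apply, hji, if_false]
    exact isIntegral_trace ((hb _).mul (hb _))

/-! ### Substitution and derivation on an extension embedded in ℂ((z)). -/

section operators
variable {L : Type*} [Field L] [Algebra (RatFunc ℂ) L] {j : L →ₐ[RatFunc ℂ] ℂ⸨X⸩}
  {ι : Type*} [Fintype ι]

theorem map_algebraMap_of_dilate {N : ℕ} [NeZero N] {t : L →+* L}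
    (ht : ∀ x, j (t x) = dilate N (j x)) (x : RatFunc ℂ) :
    t (algebraMap (RatFunc ℂ) L x) = algebraMap (RatFunc ℂ) L (ratDilate N x) := by
  refine j.injective (?_ : j _ = j _)
  rw [ht, j.commutes, j.commutes, algebraMap_ratDilate]

theorem exists_basis_eq_of_dilate {N : ℕ} [NeZero N] {t : L →+* L}
    (ht : ∀ x, j (t x) = dilate N (j x)) (b : Module.Basis ι (RatFunc ℂ) L) :
    ∃ b' : Module.Basis ι (RatFunc ℂ) L, ∀ i, b' i = t (b i) := by
  have h1 : LinearIndependent (RatFunc ℂ) fun i => j (b i) :=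
    b.linearIndependent.map' j.toLinearMap (LinearMap.ker_eq_bot.2 j.injective)
  have h2 : LinearIndependent (RatFunc ℂ) fun i => t (b i) := by
    refine LinearIndependent.of_comp j.toLinearMap ?_
    have h3 : (⇑j.toLinearMap ∘ fun i => t (b i)) = fun i => dilate N (j (b i)) :=
      funext fun i => ht _
    rw [h3]
    exact linearIndependent_dilate N h1
  rcases isEmpty_or_nonempty ι with h | h
  · exact ⟨b, fun i => h.elim i⟩
  · exact ⟨basisOfLinearIndependentOfCardEqFinrank h2 (Module.finrank_eq_card_basis b).symm,
      fun i => by simp⟩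

variable {d : L → L}

theorem theta_mul (hd : ∀ x, j (d x) = thetaLin (j x)) (x y : L) :
    d (x * y) = x * d y + y * d x := by
  refine j.injective (?_ : j _ = j _)
  rw [hd, map_mul, thetaLin_mul, map_add, map_mul, map_mul, hd, hd]

theorem theta_sum (hd : ∀ x, j (d x) = thetaLin (j x)) {ι : Type*} (s : Finset ι) (f : ι → L) :
    d (∑ i ∈ s, f i) = ∑ i ∈ s, d (f i) := by
  refine j.injective (?_ : j _ = j _)
  simp only [hd, map_sum]

theorem theta_algebraMap (hd : ∀ x, j (d x) = thetaLin (j x)) (x : RatFunc ℂ) :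
    d (algebraMap (RatFunc ℂ) L x) = algebraMap (RatFunc ℂ) L (ratTheta x) := by
  refine j.injective (?_ : j _ = j _)
  rw [hd, j.commutes, j.commutes, algebraMap_ratTheta]

theorem Module.Basis.repr_eq_sum_repr_mul {K M : Type*} [Field K] [AddCommGroup M] [Module K M]
    (b b' : Module.Basis ι K M) (x : M) (i : ι) :
    b'.repr x i = ∑ j, b.repr x j * b'.repr (b j) i := by
  conv_lhs => rw [← b.sum_repr x]
  rw [map_sum, Finsupp.finsetSum_apply]
  simp only [map_smul, Finsupp.smul_apply, smul_eq_mul]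

theorem repr_theta (hd : ∀ x, j (d x) = thetaLin (j x)) (b : Module.Basis ι (RatFunc ℂ) L)
    (f : L) (i : ι) :
    b.repr (d f) i = ratTheta (b.repr f i) + ∑ l, b.repr f l * b.repr (d (b l)) i := by
  have : d f = ∑ l, ratTheta (b.repr f l) • b l + ∑ l, b.repr f l • d (b l) := by
    conv_lhs => rw [← b.sum_repr f]
    rw [theta_sum hd, ← Finset.sum_add_distrib]
    refine Finset.sum_congr rfl fun l _ => ?_
    rw [Algebra.smul_def, theta_mul hd, theta_algebraMap hd, Algebra.smul_def, Algebra.smul_def]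
    ring
  rw [this, map_add, Finsupp.add_apply, b.repr_sum_self, map_sum, Finsupp.finsetSum_apply]
  simp only [map_smul, Finsupp.smul_apply, smul_eq_mul]

theorem theta_C_mul (hd : ∀ x, j (d x) = thetaLin (j x)) (c : ℂ) (x : L) :
    d (algebraMap (RatFunc ℂ) L (RatFunc.C c) * x) =
      algebraMap (RatFunc ℂ) L (RatFunc.C c) * d x := by
  rw [theta_mul hd, theta_algebraMap hd]
  simp [ratTheta]

theorem algebraMap_ratFunc_C (c : ℂ) :
    algebraMap (RatFunc ℂ) ℂ⸨X⸩ (RatFunc.C c) = HahnSeries.C c := by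
  rw [← RatFunc.algebraMap_C, ← IsScalarTower.algebraMap_apply, ← Polynomial.monomial_zero_left,
    algebraMap_monomial]
  rfl

theorem theta_dilate {N : ℕ} [NeZero N] {t : L →+* L} (ht : ∀ x, j (t x) = dilate N (j x))
    (hd : ∀ x, j (d x) = thetaLin (j x)) (x : L) :
    d (t x) = algebraMap (RatFunc ℂ) L (RatFunc.C (N : ℂ)) * t (d x) := by
  refine j.injective (?_ : j _ = j _)
  rw [hd, ht, thetaLin_dilate, map_mul, j.commutes, ht, hd, algebraMap_ratFunc_C,
    HahnSeries.C_mul_eq_smul]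

theorem iterate_theta_dilate {N : ℕ} [NeZero N] {t : L →+* L}
    (ht : ∀ x, j (t x) = dilate N (j x)) (hd : ∀ x, j (d x) = thetaLin (j x)) (i : ℕ) (x : L) :
    d^[i] (t x) = algebraMap (RatFunc ℂ) L (RatFunc.C ((N : ℂ) ^ i)) * t (d^[i] x) := by
  induction i with
  | zero => simp
  | succ i ih =>
    rw [Function.iterate_succ_apply', ih, theta_C_mul hd, theta_dilate ht hd, ← mul_assoc,
      ← map_mul (algebraMap (RatFunc ℂ) L), ← map_mul RatFunc.C, ← pow_succ,
      Function.iterate_succ_apply']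

theorem iterate_dilate {k : ℕ} [NeZero k] {t : L →+* L} (ht : ∀ x, j (t x) = dilate k (j x))
    (n : ℕ) (x : L) : j ((t ^ n) x) = dilate (k ^ n) (j x) := by
  induction n with
  | zero =>
    simp only [pow_zero, RingHom.one_def, RingHom.id_apply, dilate_one_apply]
  | succ n ih =>
    rw [pow_succ', RingHom.mul_def, RingHom.comp_apply, ht, ih, dilate_dilate]
    simp only [pow_succ']

end operators

/-! ### Uniform pole bounds at 0 and ∞. -/

section poleNorm
variable {L : Type*} [Field L] [Algebra (RatFunc ℂ) L] {j : L →ₐ[RatFunc ℂ] ℂ⸨X⸩}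
  {ι : Type*} [Fintype ι] {w : RatFunc ℂ → ℕ}

/-- The largest pole order of the coordinates of `x`. -/
noncomputable def poleNorm (w : RatFunc ℂ → ℕ) (b : Module.Basis ι (RatFunc ℂ) L) (x : L) : ℕ :=
  Finset.univ.sup fun i => w (b.repr x i)

theorem le_poleNorm (w : RatFunc ℂ → ℕ) (b : Module.Basis ι (RatFunc ℂ) L) (x : L) (i : ι) :
    w (b.repr x i) ≤ poleNorm w b x :=
  Finset.le_sup (f := fun i => w (b.repr x i)) (Finset.mem_univ i)

theorem poleNorm_le_iff {b : Module.Basis ι (RatFunc ℂ) L} {x : L} {B : ℕ} :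
    poleNorm w b x ≤ B ↔ ∀ i, w (b.repr x i) ≤ B := by
  simp [poleNorm]

/-- A constant is fixed by z ↦ z², so its order equals its own double. -/
theorem IsPoleOrder.C (hw : IsPoleOrder w) (c : ℂ) : w (RatFunc.C c) = 0 := by
  have h := hw.dilate 2 (RatFunc.C c)
  rw [← RatFunc.algebraMap_C, ratDilate_algebraMap, Polynomial.expand_C] at h
  rw [← RatFunc.algebraMap_C]
  omega

theorem poleNorm_C_mul_le (hw : IsPoleOrder w) (b : Module.Basis ι (RatFunc ℂ) L) (c : ℂ) (x : L) :
    poleNorm w b (algebraMap (RatFunc ℂ) L (RatFunc.C c) * x) ≤ poleNorm w b x := by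
  rw [poleNorm_le_iff]
  intro i
  rw [← Algebra.smul_def, map_smul, Finsupp.smul_apply, smul_eq_mul]
  refine (hw.mul _ _).trans ?_
  rw [hw.C, zero_add]
  exact le_poleNorm w b x i

theorem poleNorm_C_mul (hw : IsPoleOrder w) (b : Module.Basis ι (RatFunc ℂ) L) {c : ℂ} (hc : c ≠ 0)
    (x : L) : poleNorm w b (algebraMap (RatFunc ℂ) L (RatFunc.C c) * x) = poleNorm w b x := by
  refine (poleNorm_C_mul_le hw b c x).antisymm ?_
  have h := poleNorm_C_mul_le hw b c⁻¹ (algebraMap (RatFunc ℂ) L (RatFunc.C c) * x)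
  rwa [← mul_assoc, ← map_mul, ← map_mul, inv_mul_cancel₀ hc, map_one, map_one, one_mul] at h

theorem exists_poleNorm_le_add (hw : IsPoleOrder w) (b b' : Module.Basis ι (RatFunc ℂ) L) :
    ∃ C, ∀ x, poleNorm w b' x ≤ poleNorm w b x + C := by
  refine ⟨Finset.univ.sup fun l => poleNorm w b' (b l), fun x => poleNorm_le_iff.2 fun i => ?_⟩
  rw [b.repr_eq_sum_repr_mul b']
  exact hw.sum _ _ fun l _ => (hw.mul _ _).trans (add_le_add (le_poleNorm w b x l)
    ((le_poleNorm w b' (b l) i).trans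
      (Finset.le_sup (f := fun l => poleNorm w b' (b l)) (Finset.mem_univ l))))

theorem exists_poleNorm_theta_le (hw : IsPoleOrder w) {d : L → L}
    (hd : ∀ x, j (d x) = thetaLin (j x)) (b : Module.Basis ι (RatFunc ℂ) L) :
    ∃ C, ∀ x, poleNorm w b (d x) ≤ poleNorm w b x + C := by
  refine ⟨Finset.univ.sup fun l => poleNorm w b (d (b l)), fun x => poleNorm_le_iff.2 fun i => ?_⟩
  rw [repr_theta hd]
  refine (hw.add _ _).trans (max_le ?_ ?_)
  · exact (hw.theta _).trans ((le_poleNorm w b x i).trans (Nat.le_add_right _ _))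
  · exact hw.sum _ _ fun l _ => (hw.mul _ _).trans (add_le_add (le_poleNorm w b x l)
      ((le_poleNorm w b (d (b l)) i).trans
        (Finset.le_sup (f := fun l => poleNorm w b (d (b l))) (Finset.mem_univ l))))

/-- In the basis `t (b i)` the scaling by `N` is exact; returning to `b` costs a constant in each
direction. -/
theorem exists_poleNorm_dilate (hw : IsPoleOrder w) {N : ℕ} [NeZero N] {t : L →+* L}
    (ht : ∀ x, j (t x) = dilate N (j x)) (b : Module.Basis ι (RatFunc ℂ) L) :
    ∃ C, ∀ x, poleNorm w b (t x) ≤ N * poleNorm w b x + C ∧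
      N * poleNorm w b x ≤ poleNorm w b (t x) + C := by
  obtain ⟨b', hb'⟩ := exists_basis_eq_of_dilate ht b
  obtain ⟨C₁, h₁⟩ := exists_poleNorm_le_add hw b b'
  obtain ⟨C₂, h₂⟩ := exists_poleNorm_le_add hw b' b
  have key : ∀ x, poleNorm w b' (t x) = N * poleNorm w b x := by
    intro x
    rw [poleNorm, poleNorm,
      Finset.apply_sup_eq_sup_comp (fun m : ℕ => N * m)
        (fun a b => (Nat.mul_max_mul_left N a b).symm) (mul_zero N)]
    refine Finset.sup_congr rfl fun i _ => ?_
    rw [Module.Basis.repr_of_semilinear (map_algebraMap_of_dilate ht) hb', hw.dilate]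
    rfl
  refine ⟨C₁ + C₂, fun x => ⟨?_, ?_⟩⟩
  · have := h₂ (t x)
    rw [key] at this
    omega
  · have := h₁ (t x)
    rw [key] at this
    omega

theorem exists_forall_poleNorm_iterate_theta_le (hw : IsPoleOrder w) {k : ℕ} [NeZero k]
    (hk : 2 ≤ k) {t : L →+* L} (ht : ∀ x, j (t x) = dilate k (j x)) {d : L → L}
    (hd : ∀ x, j (d x) = thetaLin (j x)) (b : Module.Basis ι (RatFunc ℂ) L) (f : L) :
    ∃ B, ∀ i, poleNorm w b (d^[i] f) ≤ B := by
  obtain ⟨C, hC⟩ := exists_poleNorm_theta_le hw hd b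
  obtain ⟨E, hE⟩ := exists_poleNorm_dilate hw ht b
  have hθ : ∀ i x, poleNorm w b (d^[i] x) ≤ poleNorm w b x + C * i := by
    intro i x
    induction i with
    | zero => simp
    | succ i ih =>
      rw [Function.iterate_succ_apply', mul_add, mul_one]
      have := hC (d^[i] x)
      omega
  -- The extra `E` on the left closes the induction, since 2E ≤ kE; likewise in `hlow`.
  have hup : ∀ n x, poleNorm w b ((t ^ n) x) + E ≤ k ^ n * (poleNorm w b x + E) := by
    intro n x
    induction n with
    | zero => simp
    | succ n ih =>
      rw [pow_succ', RingHom.mul_def, RingHom.comp_apply, pow_succ', mul_assoc]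
      have h1 := (hE ((t ^ n) x)).1
      have h2 := Nat.mul_le_mul_left k ih
      have h3 := Nat.mul_le_mul_right E hk
      rw [mul_add] at h2
      omega
  have hlow : ∀ n x, k ^ n * poleNorm w b x + E ≤ poleNorm w b ((t ^ n) x) + k ^ n * E := by
    intro n x
    induction n with
    | zero => simp
    | succ n ih =>
      rw [pow_succ' t, RingHom.mul_def, RingHom.comp_apply, pow_succ', mul_assoc, mul_assoc]
      have h1 := (hE ((t ^ n) x)).2
      have h2 := Nat.mul_le_mul_left k ih
      have h3 := Nat.mul_le_mul_right E hk
      rw [mul_add, mul_add] at h2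
      omega
  refine ⟨poleNorm w b f + 2 * E + 1, fun i => ?_⟩
  -- With `C * i` substitutions, the error `C * i` caused by the derivations is less than one unit
  -- after division by k^(C i).
  have hn : C * i < k ^ (C * i) := Nat.lt_pow_self (by omega)
  have h1 := hlow (C * i) (d^[i] f)
  have h2 := hθ i ((t ^ (C * i)) f)
  rw [iterate_theta_dilate (iterate_dilate ht (C * i)) hd,
    poleNorm_C_mul hw b (pow_ne_zero _ (Nat.cast_ne_zero.2 (NeZero.ne _)))] at h2
  have h3 := hup (C * i) f
  refine (Nat.lt_of_mul_lt_mul_left (a := k ^ (C * i)) ?_).le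
  have h4 : k ^ (C * i) * (poleNorm w b f + 2 * E + 1) =
    k ^ (C * i) * (poleNorm w b f + E) + k ^ (C * i) * E + k ^ (C * i) := by ring
  omega

end poleNorm

/-! ### Excluding finite nonzero poles. -/

/-- The rational functions whose poles at finite distance are roots of `Q`. -/
def polesIn (Q : ℂ[X]) : Subalgebra ℂ[X] (RatFunc ℂ) where
  carrier := {x | ∃ (N : ℕ) (p : ℂ[X]),
    algebraMap ℂ[X] (RatFunc ℂ) (Q ^ N) * x = algebraMap ℂ[X] (RatFunc ℂ) p}
  mul_mem' := by
    rintro x y ⟨N, p, hp⟩ ⟨M, q, hq⟩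
    refine ⟨N + M, p * q, ?_⟩
    rw [pow_add, map_mul, map_mul, ← hp, ← hq]
    ring
  add_mem' := by
    rintro x y ⟨N, p, hp⟩ ⟨M, q, hq⟩
    refine ⟨N + M, Q ^ M * p + Q ^ N * q, ?_⟩
    rw [pow_add, map_mul, map_add, map_mul, map_mul, ← hp, ← hq]
    ring
  algebraMap_mem' p := ⟨0, p, by simp⟩

theorem mem_polesIn {Q : ℂ[X]} {x : RatFunc ℂ} : x ∈ polesIn Q ↔ ∃ (N : ℕ) (p : ℂ[X]),
    algebraMap ℂ[X] (RatFunc ℂ) (Q ^ N) * x = algebraMap ℂ[X] (RatFunc ℂ) p := Iff.rfl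

theorem polesIn_mono {Q R : ℂ[X]} (h : Q ∣ R) : polesIn Q ≤ polesIn R := by
  rintro x ⟨N, p, hp⟩
  obtain ⟨S, rfl⟩ := h
  refine ⟨N, S ^ N * p, ?_⟩
  rw [mul_pow, map_mul, map_mul, ← hp]
  ring

theorem denom_mul (x : RatFunc ℂ) :
    algebraMap ℂ[X] (RatFunc ℂ) x.denom * x = algebraMap ℂ[X] (RatFunc ℂ) x.num := by
  have hd : algebraMap ℂ[X] (RatFunc ℂ) x.denom ≠ 0 :=
    (map_ne_zero_iff _ (IsFractionRing.injective ℂ[X] (RatFunc ℂ))).2 x.denom_ne_zero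
  rw [mul_comm, ← eq_div_iff hd, RatFunc.num_div_denom]

theorem mem_polesIn_denom (x : RatFunc ℂ) : x ∈ polesIn x.denom :=
  ⟨1, x.num, by rw [pow_one, denom_mul]⟩

theorem ratTheta_mem_polesIn {Q : ℂ[X]} {x : RatFunc ℂ} (hx : x ∈ polesIn Q) :
    ratTheta x ∈ polesIn Q := by
  obtain ⟨N, p, hp⟩ := hx
  refine ⟨N + N, Q ^ N * (Polynomial.X * Polynomial.derivative p) -
    p * (Polynomial.X * Polynomial.derivative (Q ^ N)), ?_⟩
  apply (algebraMap (RatFunc ℂ) ℂ⸨X⸩).injective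
  have h1 := congrArg (algebraMap (RatFunc ℂ) ℂ⸨X⸩) hp
  rw [map_mul, ← IsScalarTower.algebraMap_apply, ← IsScalarTower.algebraMap_apply] at h1
  have h2 := congrArg thetaLin h1
  rw [thetaLin_mul, thetaLin_algebraMap_polynomial, thetaLin_algebraMap_polynomial] at h2
  rw [map_mul, algebraMap_ratTheta, ← IsScalarTower.algebraMap_apply,
    ← IsScalarTower.algebraMap_apply, pow_add, map_mul, map_sub, map_mul, map_mul _ p, ← h2, ← h1]
  ring

section
variable {L : Type*} [Field L] [Algebra (RatFunc ℂ) L] {j : L →ₐ[RatFunc ℂ] ℂ⸨X⸩}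
  {ι : Type*} [Fintype ι]

/-- In coordinates, `d` is the Euler derivation plus a matrix; new poles can only come from that
matrix. -/
theorem repr_iterate_theta_mem_polesIn {d : L → L} (hd : ∀ x, j (d x) = thetaLin (j x))
    {b : Module.Basis ι (RatFunc ℂ) L} {Q : ℂ[X]} (hQ : ∀ l i, b.repr (d (b l)) i ∈ polesIn Q)
    {f : L} (hf : ∀ i, b.repr f i ∈ polesIn Q) (n : ℕ) (i : ι) :
    b.repr (d^[n] f) i ∈ polesIn Q := by
  induction n generalizing i with
  | zero => exact hf i
  | succ n ih =>
    rw [Function.iterate_succ_apply', repr_theta hd]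
    exact add_mem (ratTheta_mem_polesIn (ih i)) (sum_mem fun l _ => mul_mem (ih l) (hQ l i))

variable [Algebra ℂ[X] L] [IsScalarTower ℂ[X] (RatFunc ℂ) L]

theorem exists_isIntegral_pow_mul {b : Module.Basis ι (RatFunc ℂ) L}
    (hb : ∀ i, IsIntegral ℂ[X] (b i)) {Q : ℂ[X]} {f : L} (hf : ∀ i, b.repr f i ∈ polesIn Q) :
    ∃ M : ℕ, IsIntegral ℂ[X] (algebraMap ℂ[X] L (Q ^ M) * f) := by
  classical
  choose N p hp using fun i => mem_polesIn.1 (hf i)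
  refine ⟨∑ i, N i, ?_⟩
  rw [← b.sum_repr f, Finset.mul_sum]
  refine IsIntegral.sum _ fun i _ => ?_
  rw [← Finset.sum_erase_add _ _ (Finset.mem_univ i), pow_add, map_mul, Algebra.smul_def, mul_assoc,
    ← mul_assoc (algebraMap ℂ[X] L (Q ^ N i)), IsScalarTower.algebraMap_apply ℂ[X] (RatFunc ℂ) L
      (Q ^ N i), ← map_mul, hp, ← IsScalarTower.algebraMap_apply]
  exact isIntegral_algebraMap.mul (isIntegral_algebraMap.mul (hb i))

theorem IsIntegral.map_dilate {N : ℕ} [NeZero N] {t : L →+* L}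
    (ht : ∀ x, j (t x) = dilate N (j x)) {x : L} (hx : IsIntegral ℂ[X] x) :
    IsIntegral ℂ[X] (t x) := by
  refine hx.map_of_comp_eq (Polynomial.expand ℂ N).toRingHom t
    (RingHom.ext fun p => ?_)
  change algebraMap ℂ[X] L (Polynomial.expand ℂ N p) = t (algebraMap ℂ[X] L p)
  rw [IsScalarTower.algebraMap_apply ℂ[X] (RatFunc ℂ) L,
    IsScalarTower.algebraMap_apply ℂ[X] (RatFunc ℂ) L, map_algebraMap_of_dilate ht,
    ratDilate_algebraMap]

variable [FiniteDimensional (RatFunc ℂ) L]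

theorem exists_X_pow_mul_discr_mul_repr [DecidableEq ι] {k : ℕ} [NeZero k] (hk : 2 ≤ k)
    {t : L →+* L} (ht : ∀ x, j (t x) = dilate k (j x)) {d : L → L}
    (hd : ∀ x, j (d x) = thetaLin (j x)) {b : Module.Basis ι (RatFunc ℂ) L}
    (hb : ∀ i, IsIntegral ℂ[X] (b i)) {f : L} (hf : IsIntegral ℂ[X] f) (m : ℕ) (i : ι) :
    ∃ (s : ℕ) (p : ℂ[X]), algebraMap ℂ[X] (RatFunc ℂ) (Polynomial.X ^ s) *
      (Algebra.discr (RatFunc ℂ) b * b.repr (d^[m] f) i) = algebraMap ℂ[X] (RatFunc ℂ) p := by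
  obtain ⟨D, hD⟩ := IsIntegrallyClosed.isIntegral_iff.1 (Algebra.discr_isIntegral (RatFunc ℂ) hb)
  have hD0 : D ≠ 0 := by
    rintro rfl
    exact Algebra.discr_not_zero_of_basis (RatFunc ℂ) b (by rw [← hD, map_zero])
  -- `Q` covers the discriminant and the matrix of `d`, and depends on neither `n` nor `m`.
  set Q : ℂ[X] := D * ∏ l, ∏ i, (b.repr (d (b l)) i).denom with hQdef
  have hQ0 : Q ≠ 0 := mul_ne_zero hD0 (Finset.prod_ne_zero_iff.2 fun l _ =>
    Finset.prod_ne_zero_iff.2 fun i _ => RatFunc.denom_ne_zero _)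
  have hQ : ∀ l i, b.repr (d (b l)) i ∈ polesIn Q := fun l i =>
    polesIn_mono (((Finset.dvd_prod_of_mem (fun i => (b.repr (d (b l)) i).denom)
      (Finset.mem_univ i)).trans (Finset.dvd_prod_of_mem
        (fun l => ∏ i, (b.repr (d (b l)) i).denom) (Finset.mem_univ l))).trans (dvd_mul_left _ _))
      (mem_polesIn_denom _)
  have hint : ∀ g : L, IsIntegral ℂ[X] g → ∀ i, b.repr g i ∈ polesIn Q := fun g hg i => by
    obtain ⟨r, hr⟩ := Algebra.exists_algebraMap_eq_discr_mul_repr b hb hg i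
    exact polesIn_mono (dvd_mul_right D _) ⟨1, r, by rw [pow_one, hD, hr]⟩
  refine exists_X_pow_mul_of_forall_ratDilate hk hQ0 _ fun n => ?_
  have htn := iterate_dilate ht n
  obtain ⟨M, hM⟩ := exists_isIntegral_pow_mul hb (repr_iterate_theta_mem_polesIn hd hQ
    (hint _ (hf.map_dilate htn)) m)
  have hNm : ((k ^ n : ℕ) : ℂ) ^ m ≠ 0 := pow_ne_zero _ (Nat.cast_ne_zero.2 (NeZero.ne _))
  have hM' : IsIntegral ℂ[X] (algebraMap ℂ[X] L (Q ^ M) * (t ^ n) (d^[m] f)) := by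
    have h := (isIntegral_algebraMap (R := ℂ[X]) (A := L)
      (x := Polynomial.C (((k ^ n : ℕ) : ℂ) ^ m)⁻¹)).mul hM
    rw [iterate_theta_dilate htn hd, ← RatFunc.algebraMap_C, ← IsScalarTower.algebraMap_apply,
      mul_left_comm, ← mul_assoc (algebraMap ℂ[X] L (Polynomial.C _)), ← map_mul, ← map_mul,
      inv_mul_cancel₀ hNm, map_one, map_one, one_mul] at h
    exact h
  -- In the basis t^n b, both discriminant and coordinates are the dilated ones, so integrality
  -- controls the dilate of the desired product.
  obtain ⟨b', hb'⟩ := exists_basis_eq_of_dilate htn b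
  obtain ⟨r, hr⟩ := Algebra.exists_algebraMap_eq_discr_mul_repr b'
    (fun i => by rw [hb']; exact (hb i).map_dilate htn) hM' i
  refine ⟨M, r, ?_⟩
  have hs := map_algebraMap_of_dilate htn
  rw [Algebra.discr_of_semilinear hs hb', IsScalarTower.algebraMap_apply ℂ[X] (RatFunc ℂ) L,
    ← Algebra.smul_def, map_smul, Finsupp.smul_apply, Module.Basis.repr_of_semilinear hs hb',
    smul_eq_mul] at hr
  rw [hr, map_mul]
  ring

end

/-! ### From bounded poles to finite support. -/

theorem exists_X_pow_mul_eq_of_poleOrder_le {y : RatFunc ℂ} {s : ℕ} {p : ℂ[X]}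
    (h : algebraMap ℂ[X] (RatFunc ℂ) (Polynomial.X ^ s) * y = algebraMap ℂ[X] (RatFunc ℂ) p) {B : ℕ}
    (h₀ : poleOrderZero y ≤ B) (h₁ : poleOrderInfty y ≤ B) :
    ∃ q : ℂ[X], q.natDegree ≤ B + B ∧
      algebraMap ℂ[X] (RatFunc ℂ) (Polynomial.X ^ B) * y = algebraMap ℂ[X] (RatFunc ℂ) q := by
  have hi := IsFractionRing.injective ℂ[X] (RatFunc ℂ)
  have hX : ∀ n, algebraMap ℂ[X] (RatFunc ℂ) (Polynomial.X ^ n) ≠ 0 := fun n =>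
    (map_ne_zero_iff _ hi).2 (pow_ne_zero _ Polynomial.X_ne_zero)
  by_cases hy : y = 0
  · exact ⟨0, by simp, by simp [hy]⟩
  have hq : ∃ q : ℂ[X],
      algebraMap ℂ[X] (RatFunc ℂ) (Polynomial.X ^ B) * y = algebraMap ℂ[X] (RatFunc ℂ) q := by
    -- Since `y` has order at least -B at 0, p = X^s y has order at least s - B; truncated
    -- subtraction makes the claim trivial if s ≤ B.
    have hdvd : (Polynomial.X : ℂ[X]) ^ (s - B) ∣ p := by
      rw [Polynomial.X_pow_dvd_iff]
      intro e he
      have h2 := congrArg (fun x => (algebraMap (RatFunc ℂ) ℂ⸨X⸩ x).coeff e) h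
      simp only [map_mul (algebraMap (RatFunc ℂ) ℂ⸨X⸩)] at h2
      rw [← IsScalarTower.algebraMap_apply, ← IsScalarTower.algebraMap_apply,
        ← Polynomial.monomial_one_right_eq_X_pow, algebraMap_monomial, HahnSeries.coeff_single_mul,
        HahnSeries.coeff_eq_zero_of_lt_order, mul_zero, algebraMap_polynomial_eq_coe,
        PowerSeries.coeff_coe, if_neg (by omega), Int.natAbs_natCast, Polynomial.coeff_coe] at h2
      · exact h2.symm
      · rw [poleOrderZero] at h₀
        omega
    obtain ⟨q, rfl⟩ := hdvd
    rcases le_total s B with hs | hs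
    · refine ⟨Polynomial.X ^ (B - s) * (Polynomial.X ^ (s - B) * q), ?_⟩
      rw [map_mul, ← h, ← mul_assoc, ← map_mul, ← pow_add, Nat.sub_add_cancel hs]
    · refine ⟨q, mul_left_cancel₀ (hX (s - B)) ?_⟩
      rw [← map_mul _ _ q, ← h, ← mul_assoc, ← map_mul, ← pow_add, Nat.sub_add_cancel hs]
  obtain ⟨q, hq⟩ := hq
  refine ⟨q, ?_, hq⟩
  have h2 := congrArg RatFunc.intDegree hq
  rw [RatFunc.intDegree_mul (hX B) hy, RatFunc.intDegree_polynomial, RatFunc.intDegree_polynomial,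
    Polynomial.natDegree_X_pow] at h2
  rw [poleOrderInfty] at h₁
  omega

theorem coeff_iterate_thetaLin (f : ℂ⸨X⸩) (i : ℕ) (n : ℤ) :
    (thetaLin^[i] f).coeff n = (n : ℂ) ^ i * f.coeff n := by
  induction i with
  | zero => simp
  | succ i ih => rw [Function.iterate_succ_apply', coeff_thetaLin, ih, pow_succ', mul_assoc]

/-- θ multiplies the n-th coefficient by n, so every support index is a root of the nonzero
polynomial ∑ c_i x^i. -/
theorem finite_support_of_sum_smul_iterate_thetaLin_eq_zero {f : ℂ⸨X⸩} {s : Finset ℕ} {c : ℕ → ℂ}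
    (h : ∑ i ∈ s, HahnSeries.C (c i) * thetaLin^[i] f = 0) {i : ℕ} (hi : i ∈ s) (hc : c i ≠ 0) :
    f.support.Finite := by
  set P : ℂ[X] := ∑ i ∈ s, Polynomial.monomial i (c i) with hP
  have hP0 : P ≠ 0 := by
    intro h0
    have := congrArg (fun p : ℂ[X] => p.coeff i) h0
    simp only [hP, Polynomial.finsetSum_coeff, Polynomial.coeff_monomial, Finset.sum_ite_eq', hi,
      if_true, Polynomial.coeff_zero] at this
    exact hc this
  have hroots : {x : ℂ | P.IsRoot x}.Finite := Polynomial.finite_setOfPred_isRoot hP0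
  refine (hroots.preimage (f := fun n : ℤ => (n : ℂ)) Int.cast_injective.injOn).subset fun n hn => ?_
  have hcoeff := congrArg (fun g : ℂ⸨X⸩ => g.coeff n) h
  simp only [HahnSeries.coeff_sum, HahnSeries.C_mul_eq_smul, HahnSeries.coeff_smul,
    coeff_iterate_thetaLin, HahnSeries.coeff_zero, smul_eq_mul, ← mul_assoc] at hcoeff
  rw [← Finset.sum_mul] at hcoeff
  have := (mul_eq_zero.1 hcoeff).resolve_right hn
  simp only [Set.mem_preimage, Set.mem_ofPred_eq, Polynomial.IsRoot, hP, Polynomial.eval_finsetSum,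
    Polynomial.eval_monomial]
  exact this

section
variable {L : Type*} [Field L] [Algebra (RatFunc ℂ) L] {j : L →ₐ[RatFunc ℂ] ℂ⸨X⸩}

theorem iterate_theta {d : L → L} (hd : ∀ x, j (d x) = thetaLin (j x)) (i : ℕ) (x : L) :
    j (d^[i] x) = thetaLin^[i] (j x) := by
  induction i with
  | zero => rfl
  | succ i ih => rw [Function.iterate_succ_apply', hd, ih, Function.iterate_succ_apply']

theorem finite_support_of_isIntegral [Algebra ℂ[X] L] [IsScalarTower ℂ[X] (RatFunc ℂ) L]
    [FiniteDimensional (RatFunc ℂ) L] {k : ℕ} [NeZero k] (hk : 2 ≤ k)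
    {t : L →+* L} (ht : ∀ x, j (t x) = dilate k (j x)) {d : L → L}
    (hd : ∀ x, j (d x) = thetaLin (j x)) {f : L} (hf : IsIntegral ℂ[X] f) :
    (j f).support.Finite := by
  classical
  obtain ⟨S, b, hb⟩ := FiniteDimensional.exists_is_basis_integral ℂ[X] (RatFunc ℂ) L
  obtain ⟨B₀, hB₀⟩ :=
    exists_forall_poleNorm_iterate_theta_le isPoleOrder_poleOrderZero hk ht hd b f
  obtain ⟨B₁, hB₁⟩ :=
    exists_forall_poleNorm_iterate_theta_le isPoleOrder_poleOrderInfty hk ht hd b f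
  set Δ := Algebra.discr (RatFunc ℂ) b with hΔ
  have hΔ0 : Δ ≠ 0 := Algebra.discr_not_zero_of_basis (RatFunc ℂ) b
  set B := poleOrderZero Δ + B₀ + (poleOrderInfty Δ + B₁) with hB
  have hq : ∀ (m : ℕ) (i : S), ∃ q : ℂ[X], q.natDegree ≤ B + B ∧
      algebraMap ℂ[X] (RatFunc ℂ) (Polynomial.X ^ B) * (Δ * b.repr (d^[m] f) i) =
        algebraMap ℂ[X] (RatFunc ℂ) q := by
    intro m i
    obtain ⟨s, p, hp⟩ := exists_X_pow_mul_discr_mul_repr hk ht hd hb hf m i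
    rw [← hΔ] at hp
    refine exists_X_pow_mul_eq_of_poleOrder_le hp ?_ ?_
    · have h1 := isPoleOrder_poleOrderZero.mul Δ (b.repr (d^[m] f) i)
      have h2 := (le_poleNorm poleOrderZero b (d^[m] f) i).trans (hB₀ m)
      omega
    · have h1 := isPoleOrder_poleOrderInfty.mul Δ (b.repr (d^[m] f) i)
      have h2 := (le_poleNorm poleOrderInfty b (d^[m] f) i).trans (hB₁ m)
      omega
  choose q hqdeg hq using hq
  let v : ℕ → S → Polynomial.degreeLT ℂ (B + B + 1) := fun m i =>
    ⟨q m i, Polynomial.mem_degreeLT.2 ((Polynomial.degree_le_of_natDegree_le (hqdeg m i)).trans_lt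
      (by exact_mod_cast Nat.lt_succ_self _))⟩
  -- An infinite family, indexed by the iterates of `d`, lies in a finite-dimensional complex space.
  have hv : ¬ LinearIndependent ℂ v := fun h => by
    have : Module.Finite ℂ (Polynomial.degreeLT ℂ (B + B + 1)) :=
      Module.Finite.equiv (Polynomial.degreeLTEquiv ℂ (B + B + 1)).symm
    exact not_finite_iff_infinite.2 inferInstance h.finite
  rw [not_linearIndependent_iff] at hv
  obtain ⟨s, c, hsum, i, hi, hci⟩ := hv
  have hsum' : ∀ l, ∑ m ∈ s, Polynomial.C (c m) * q m l = 0 := by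
    intro l
    have := congrArg (fun g : S → Polynomial.degreeLT ℂ (B + B + 1) => (g l : ℂ[X])) hsum
    simpa [v, Finset.sum_apply, Polynomial.smul_eq_C_mul] using this
  have hzero : ∑ m ∈ s, algebraMap (RatFunc ℂ) L (RatFunc.C (c m)) * d^[m] f = 0 := by
    have hu : algebraMap ℂ[X] (RatFunc ℂ) (Polynomial.X ^ B) * Δ ≠ 0 := mul_ne_zero
      ((map_ne_zero_iff _ (IsFractionRing.injective ℂ[X] (RatFunc ℂ))).2
        (pow_ne_zero _ Polynomial.X_ne_zero)) hΔ0
    apply b.repr.injective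
    ext l
    rw [map_sum, Finsupp.finsetSum_apply, map_zero, Finsupp.zero_apply]
    refine (mul_eq_zero_iff_left hu).1 ?_
    rw [Finset.mul_sum, ← map_zero (algebraMap ℂ[X] (RatFunc ℂ)), ← hsum' l, map_sum]
    refine Finset.sum_congr rfl fun m _ => ?_
    rw [← Algebra.smul_def (R := RatFunc ℂ) (A := L), map_smul, Finsupp.smul_apply, map_mul, ← hq, smul_eq_mul,
      RatFunc.algebraMap_C]
    ring
  refine finite_support_of_sum_smul_iterate_thetaLin_eq_zero (s := s) (c := c) ?_ hi hci
  have := congrArg j hzero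
  simpa only [map_sum, map_mul, j.commutes, algebraMap_ratFunc_C, iterate_theta hd, map_zero]
    using this

theorem exists_finite_support_mul [FiniteDimensional (RatFunc ℂ) L] {k : ℕ} [NeZero k]
    (hk : 2 ≤ k) {t : L →+* L} (ht : ∀ x, j (t x) = dilate k (j x)) {d : L → L}
    (hd : ∀ x, j (d x) = thetaLin (j x)) (f : L) :
    ∃ q : ℂ[X], q ≠ 0 ∧ (algebraMap ℂ[X] ℂ⸨X⸩ q * j f).support.Finite := by
  let _ : Algebra ℂ[X] L :=
    ((algebraMap (RatFunc ℂ) L).comp (algebraMap ℂ[X] (RatFunc ℂ))).toAlgebra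
  have _ : IsScalarTower ℂ[X] (RatFunc ℂ) L := IsScalarTower.of_algebraMap_eq fun _ => rfl
  obtain ⟨q, hq0, hq⟩ := exists_integral_multiples ℂ[X] (RatFunc ℂ) ({f} : Finset L)
  refine ⟨q, hq0, ?_⟩
  have h := finite_support_of_isIntegral hk ht hd (hq f (Finset.mem_singleton_self f))
  rwa [Algebra.smul_def, map_mul, IsScalarTower.algebraMap_apply ℂ[X] (RatFunc ℂ) L, j.commutes,
    ← IsScalarTower.algebraMap_apply] at h

end

/-! ### The stable field generated by a Mahler function, and the conclusion. -/

theorem thetaLin_mem_of_isAlgebraic {L : IntermediateField (RatFunc ℂ) ℂ⸨X⸩} {f : ℂ⸨X⸩}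
    (hf : f ∈ L) (halg : IsAlgebraic (RatFunc ℂ) f) : thetaLin f ∈ L := by
  have haeval : ∀ P : (RatFunc ℂ)[X], Polynomial.aeval f P ∈ L := fun P =>
    Algebra.adjoin_le (S := L.toSubalgebra) (Set.singleton_subset_iff.2 hf)
      (Polynomial.aeval_mem_adjoin_singleton _ _)
  -- The difference is `P` with θ applied to its coefficients, evaluated at `f`. For the minimal
  -- polynomial the first term vanishes and separability allows solving for θf.
  have key : ∀ P : (RatFunc ℂ)[X],
      thetaLin (Polynomial.aeval f P) - Polynomial.aeval f (Polynomial.derivative P) * thetaLin f ∈ L := by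
    intro P
    induction P using Polynomial.induction_on with
    | C a =>
      rw [Polynomial.aeval_C, Polynomial.derivative_C, map_zero, zero_mul, sub_zero,
        ← algebraMap_ratTheta]
      exact L.algebraMap_mem _
    | add P Q hP hQ =>
      have := add_mem hP hQ
      rw [map_add, map_add, map_add, map_add]
      convert this using 1
      ring
    | monomial n a h =>
      rw [pow_succ, ← mul_assoc]
      have h1 := mul_mem hf h
      have h2 : thetaLin (Polynomial.aeval f (Polynomial.C a * Polynomial.X ^ n * Polynomial.X)) -
          Polynomial.aeval f (Polynomial.derivative
            (Polynomial.C a * Polynomial.X ^ n * Polynomial.X)) * thetaLin f =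
          f * (thetaLin (Polynomial.aeval f (Polynomial.C a * Polynomial.X ^ n)) -
            Polynomial.aeval f (Polynomial.derivative (Polynomial.C a * Polynomial.X ^ n)) *
              thetaLin f) := by
        rw [map_mul (Polynomial.aeval f) (_ * _), Polynomial.aeval_X, thetaLin_mul,
          Polynomial.derivative_mul (f := _ * _), Polynomial.derivative_X, mul_one, map_add,
          map_mul (Polynomial.aeval f) (Polynomial.derivative _), Polynomial.aeval_X]
        ring
      rw [h2]
      exact h1
  have hint := halg.isIntegral
  have h := key (minpoly (RatFunc ℂ) f)
  have hne : Polynomial.aeval f (Polynomial.derivative (minpoly (RatFunc ℂ) f)) ≠ 0 :=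
    (minpoly.irreducible hint).separable.aeval_derivative_ne_zero (minpoly.aeval _ _)
  rw [minpoly.aeval, map_zero, zero_sub, neg_mem_iff] at h
  have := mul_mem (inv_mem (haeval (Polynomial.derivative (minpoly (RatFunc ℂ) f)))) h
  rwa [inv_mul_cancel_left₀ hne] at this

theorem IsAlgebraic.dilate {f : ℂ⸨X⸩} (hf : IsAlgebraic (RatFunc ℂ) f) (N : ℕ) [NeZero N] :
    IsAlgebraic (RatFunc ℂ) (dilate N f) := by
  have h : IsIntegral (RatFunc ℂ) f := hf.isIntegral
  exact (h.map_of_comp_eq (ratDilate N) (_root_.dilate N)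
    (RingHom.ext fun x => algebraMap_ratDilate N x)).isAlgebraic

theorem dilate_mem_adjoin {N : ℕ} [NeZero N] {S : Set ℂ⸨X⸩}
    (hS : ∀ x ∈ S, dilate N x ∈ IntermediateField.adjoin (RatFunc ℂ) S) {x : ℂ⸨X⸩}
    (hx : x ∈ IntermediateField.adjoin (RatFunc ℂ) S) :
    dilate N x ∈ IntermediateField.adjoin (RatFunc ℂ) S := by
  induction hx using IntermediateField.adjoin_induction with
  | mem x hx => exact hS x hx
  | algebraMap x =>
    rw [← algebraMap_ratDilate]
    exact IntermediateField.algebraMap_mem _ _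
  | add x y _ _ hx hy => rw [map_add]; exact add_mem hx hy
  | inv x _ hx => rw [map_inv₀]; exact inv_mem hx
  | mul x y _ _ hx hy => rw [map_mul]; exact mul_mem hx hy

theorem IsMahler.exists_dilate_stable {k : ℕ} [NeZero k] {F : ℂ⟦X⟧} (hF : IsMahler k F)
    (halg : IsAlgebraicSeries F) : ∃ L : IntermediateField (RatFunc ℂ) ℂ⸨X⸩,
      FiniteDimensional (RatFunc ℂ) L ∧ (F : ℂ⸨X⸩) ∈ L ∧ ∀ x ∈ L, dilate k x ∈ L := by
  obtain ⟨n, a, ha, hsum⟩ := hF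
  set S : Set ℂ⸨X⸩ := (fun i => dilate (k ^ i) (F : ℂ⸨X⸩)) '' Set.Iio n with hS
  set L := IntermediateField.adjoin (RatFunc ℂ) S with hL
  have hlt : ∀ i < n, dilate (k ^ i) (F : ℂ⸨X⸩) ∈ L := fun i hi =>
    IntermediateField.subset_adjoin _ _ ⟨i, hi, rfl⟩
  -- The Mahler equation is solved for its last term, whose coefficient is nonzero.
  have hn : dilate (k ^ n) (F : ℂ⸨X⸩) ∈ L := by
    have h := congrArg (fun G : ℂ⟦X⟧ => (G : ℂ⸨X⸩)) hsum
    simp only [Fin.sum_univ_castSucc, map_add, map_sum, map_mul, ← dilate_coe, map_zero] at h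
    have hlast : algebraMap ℂ[X] ℂ⸨X⸩ (a (Fin.last n)) ≠ 0 :=
      (map_ne_zero_iff _ (FaithfulSMul.algebraMap_injective _ _)).2 (right_ne_zero_of_mul ha)
    have hmem : ∀ p : ℂ[X], algebraMap ℂ[X] ℂ⸨X⸩ p ∈ L := fun p => by
      rw [IsScalarTower.algebraMap_apply ℂ[X] (RatFunc ℂ) ℂ⸨X⸩]
      exact L.algebraMap_mem _
    have h1 := eq_neg_of_add_eq_zero_right h
    have h2 : algebraMap ℂ[X] ℂ⸨X⸩ (a (Fin.last n)) * dilate (k ^ n) (F : ℂ⸨X⸩) ∈ L := by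
      change algebraMap ℂ[X] ℂ⸨X⸩ (a (Fin.last n)) * dilate (k ^ n) (F : ℂ⸨X⸩) = _ at h1
      rw [h1]
      exact neg_mem (sum_mem fun i _ => mul_mem (hmem _) (hlt _ i.2))
    have h3 := mul_mem (inv_mem (hmem (a (Fin.last n)))) h2
    rwa [inv_mul_cancel_left₀ hlast] at h3
  have hle : ∀ i ≤ n, dilate (k ^ i) (F : ℂ⸨X⸩) ∈ L := fun i hi => by
    rcases hi.lt_or_eq with h | rfl
    · exact hlt i h
    · exact hn
  refine ⟨L, ?_, ?_, fun x hx => dilate_mem_adjoin ?_ hx⟩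
  · have : Finite S := (Set.finite_Iio n).image _
    refine IntermediateField.finiteDimensional_adjoin ?_
    rintro _ ⟨i, -, rfl⟩
    exact (IsAlgebraic.dilate halg (k ^ i)).isIntegral
  -- The case n = 0 has no generators, hence `hle` and not `hlt`.
  · have := hle 0 (Nat.zero_le n)
    simpa only [pow_zero, dilate_one_apply] using this
  · rintro _ ⟨i, hi, rfl⟩
    have := hle (i + 1) hi
    simpa only [dilate_dilate, pow_succ'] using this

theorem exists_coe_eq_of_finite_support {G : ℂ⟦X⟧} (h : (G : ℂ⸨X⸩).support.Finite) :
    ∃ p : ℂ[X], (p : ℂ⟦X⟧) = G := by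
  obtain ⟨B, hB⟩ := h.bddAbove
  refine ⟨G.trunc (B.toNat + 1), ?_⟩
  ext n
  rw [Polynomial.coeff_coe, PowerSeries.coeff_trunc]
  split_ifs with hn
  · rfl
  · by_contra hne
    have : (n : ℤ) ∈ (G : ℂ⸨X⸩).support := by
      rw [HahnSeries.mem_support, LaurentSeries.coeff_coe_powerSeries]
      exact fun h => hne h.symm
    have := hB this
    omega

set_option synthInstance.maxHeartbeats 400000 in
theorem IsMahler.exists_finite_support_mul {k : ℕ} (hk : 2 ≤ k) {F : ℂ⟦X⟧} (hF : IsMahler k F)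
    (halg : IsAlgebraicSeries F) :
    ∃ q : ℂ[X], q ≠ 0 ∧ (algebraMap ℂ[X] ℂ⸨X⸩ q * (F : ℂ⸨X⸩)).support.Finite := by
  have : NeZero k := ⟨by omega⟩
  obtain ⟨L, hfin, hFL, ht⟩ := hF.exists_dilate_stable halg
  have hθ : ∀ x ∈ L, thetaLin x ∈ L := fun x hx => thetaLin_mem_of_isAlgebraic hx
    ((IntermediateField.isAlgebraic_iff (x := (⟨x, hx⟩ : L))).1 (Algebra.IsAlgebraic.isAlgebraic _))
  exact _root_.exists_finite_support_mul (L := L) (j := L.val) hk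
    (t := (dilate k).restrict L L ht) (fun _ => rfl) (d := fun x => ⟨thetaLin x, hθ x x.2⟩)
    (fun _ => rfl) ⟨F, hFL⟩

theorem mainTheorem4 (k : ℕ) (hk : 2 ≤ k) (F : ℂ⟦X⟧) (hF : IsMahler k F)
    (halg : IsAlgebraicSeries F) : IsRationalSeries F := by
  obtain ⟨q, hq0, hsupp⟩ := hF.exists_finite_support_mul hk halg
  obtain ⟨p, hp⟩ := exists_coe_eq_of_finite_support (G := q * F) (by rwa [map_mul])
  refine ⟨algebraMap ℂ[X] (RatFunc ℂ) p / algebraMap ℂ[X] (RatFunc ℂ) q, ?_⟩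
  have hq0' : algebraMap ℂ[X] ℂ⸨X⸩ q ≠ 0 :=
    (map_ne_zero_iff _ (FaithfulSMul.algebraMap_injective _ _)).2 hq0
  rw [map_div₀, ← IsScalarTower.algebraMap_apply, ← IsScalarTower.algebraMap_apply,
    div_eq_iff hq0', algebraMap_polynomial_eq_coe, algebraMap_polynomial_eq_coe, hp, map_mul,
    mul_comm]
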